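/- All groups are finite. Let a group $H$ act by automorphisms on a solvable group $G$, and let $GH$ denote the semidirect product $G\rtimes H$. Let $F$ be an $H$-invariant Carter subgroup of $G$ (that is, $F$ is nilpotent and $N_G(F)=F$) such that $FH$ is a Frobenius group with kernel $F$ and complement $H$ (that is, $F\neq 1$, $H\neq 1$, and $C_F(h)=1$ for every $1\neq h\in H$). Let $p$ and $q$ be distinct primes, let $Q$ be a $q$-subgroup of $G$ with $Q\trianglelefteq GH$, and let $V$ be a $kGH$-module (of arbitrary dimension) over a field $k$ of characteristic $p$ on which $Q$ acts nontrivially. Write $C_V(S)$ for the subspace of vectors fixed by a subgroup $S$, $[U,h]=\{hu-u : u\in U\}$ for an $h$-invariant subspace $U$ of $V$, and $\mathrm{Ker}(S \text{ on } U)$ for the subgroup of those elements of $S$ that fix every vector of $U$. Suppose that one of the following holds: (i) $[C_V(F),h]=C_V(F)$ for every nonidentity $h\in H$; (ii) $p=\operatorname{char} k$ is coprime to $|H|$. Then $$\mathrm{Ker}(C_Q(H)\text{ on }C_V(H))=\mathrm{Ker}(C_Q(H)\text{ on }V).$$ -/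

import Mathlib

namespace FrobeniusCarter

/-- A Carter subgroup of a finite group: a nilpotent self-normalizing subgroup. -/
structure IsCarter {G : Type*} [Group G] (F : Subgroup G) : Prop where
  nilpotent : Group.IsNilpotent F
  normalizer_eq : Subgroup.normalizer (F : Set G) = F

/-- For subgroups `N` and `A` of a group `X`: the product `NA` is (an internal semidirect product
and) a Frobenius group with kernel `N` and complement `A`. That is, `N` and `A` are nontrivial,
`A` normalizes `N`, `N ∩ A = 1`, and no nonidentity element of `A` commutes with a nonidentity
element of `N`. -/
structure IsFrobeniusProduct {X : Type*} [Group X] (N A : Subgroup X) : Prop where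
  kernel_ne_bot : N ≠ ⊥
  complement_ne_bot : A ≠ ⊥
  normalizes : A ≤ Subgroup.normalizer (N : Set X)
  disjoint : Disjoint N A
  fixedPointFree : ∀ a ∈ A, a ≠ 1 → ∀ n ∈ N, a * n * a⁻¹ = n → n = 1

section Module

variable {k X V : Type*} [Field k] [Group X] [AddCommGroup V] [Module k V]

/-- `C_V(S)`: the vectors fixed by every element of the subgroup `S`. -/
noncomputable def fixedSpace (ρ : Representation k X V) (S : Subgroup X) : Submodule k V :=
  Representation.invariants (ρ.comp S.subtype)

/-- `[U, x]`: the subspace of all `x u - u` with `u ∈ U`. -/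
def commutatorSpace (ρ : Representation k X V) (U : Submodule k V) (x : X) : Submodule k V :=
  U.map (ρ x - LinearMap.id)

/-- `Ker(S on U)`: the subgroup of those elements of `S` that fix every vector of `U`. -/
def kerOn (ρ : Representation k X V) (S : Subgroup X) (U : Submodule k V) : Subgroup X where
  carrier := {x | x ∈ S ∧ ∀ u ∈ U, ρ x u = u}
  one_mem' := ⟨S.one_mem, fun u _ => by simp⟩
  mul_mem' := fun {a b} ha hb => ⟨S.mul_mem ha.1 hb.1, fun u hu => by
    rw [map_mul, Module.End.mul_apply, hb.2 u hu, ha.2 u hu]⟩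
  inv_mem' := fun {a} ha => ⟨S.inv_mem ha.1, fun u hu => by
    conv_lhs => rw [← ha.2 u hu]
    rw [← Module.End.mul_apply, ← map_mul, inv_mul_cancel, map_one, Module.End.one_apply]⟩

end Module

section Semidirect

variable {G H : Type*} [Group G] [Group H]

/-- A subgroup `S` of `G`, viewed as a subgroup of the semidirect product `GH`. -/
def base (φ : H →* MulAut G) (S : Subgroup G) : Subgroup (G ⋊[φ] H) :=
  S.map SemidirectProduct.inl

/-- `H`, viewed as a subgroup of the semidirect product `GH`. -/
def top (φ : H →* MulAut G) : Subgroup (G ⋊[φ] H) :=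
  (SemidirectProduct.inr : H →* G ⋊[φ] H).range

/-- `C_Q(H)`, as a subgroup of the semidirect product `GH`. -/
def centralizerIn (φ : H →* MulAut G) (Q : Subgroup G) : Subgroup (G ⋊[φ] H) :=
  base φ Q ⊓ Subgroup.centralizer (top φ : Set (G ⋊[φ] H))

end Semidirect

end FrobeniusCarter

/-! Write `F = K × P` with `K` the `q'`-part and `P` the `q`-part. Since `F` is a Carter subgroup,
`C_Q(K) ≤ F`, so nonidentity elements of `H` act without fixed points on `K` and on `C_Q(K)`. Let `x
∈ C_Q(H)` be trivial on `C_V(H)`; this enters only through the operator identity `(∑ h) (x - 1) =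
0`, the sum running over `H`. Replace `Q` by the subgroup `Q₀` generated by the `K`-conjugates of
`x`, and extend scalars to the algebraic closure.

One descends the lower central series `γᵢ` of `Q₀`, proving `(∑ n) (x - 1) = 0` for the sum over
`γᵢ`; at the trivial term this says `x = 1`. To pass from `γᵢ` to `γᵢ₊₁`, split the sum over `γᵢ₊₁`
into idempotents `e` of the linear characters of `γᵢ/γᵢ₊₁`. They commute with `Q₀`, are permuted by
`KH`, and it must be shown that `x e = e` (`map_mul_idempotent_eq`).

If `e` is orthogonal to its nontrivial `H`-conjugates, compressing `(∑ h) (x - 1) = 0` by `e` gives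
`x e = e`. A counting argument (`smul_eq_of_fixed`) shows that at most one point of the `K`-orbit of
`e` has a nontrivial stabilizer in `H`. If `e` is that point and the character is nontrivial, one
builds an element of `Q₀` that acts on the whole orbit by one scalar `d ≠ 1`. Coprime action makes
it commute with `K`, and fixed-point-freeness on `C_Q(K)` then forces `d = 1`. -/

namespace FrobeniusCarter

/-! ### Counting fixed points in a finite permutation group -/

section Counting

/-- If every nonidentity element of a finite group fixes exactly one point of a finite set, then
all nonidentity elements fix the same point. -/
theorem eq_of_existsUnique_fixed {A Ω : Type*} [Group A] [Finite A] [MulAction A Ω] [Finite Ω]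
    (hu : ∀ a : A, a ≠ 1 → ∃! w : Ω, a • w = w) {a₀ a₁ : A} (ha₀ : a₀ ≠ 1) (ha₁ : a₁ ≠ 1)
    {w₀ w₁ : Ω} (h₀ : a₀ • w₀ = w₀) (h₁ : a₁ • w₁ = w₁) : w₀ = w₁ := by
  classical
  have := Fintype.ofFinite A
  have := Fintype.ofFinite Ω
  have : Nonempty Ω := ⟨w₀⟩
  choose! f hf hfu using hu
  -- The extra `1` is the identity, which lies in every stabilizer but is not assigned a fixed point
  -- by `f`.
  have fib : ∀ w : Ω, ({a ∈ (Finset.univ.erase (1 : A)) | f a = w}.card + 1 : ℕ) =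
      Nat.card (MulAction.stabilizer A w) := by
    intro w
    have : insert (1 : A) {a ∈ (Finset.univ.erase (1 : A)) | f a = w} =
        Finset.univ.filter (fun a => a ∈ MulAction.stabilizer A w) := by
      ext a
      by_cases ha : a = 1
      · simp [ha]
      · simp only [Finset.mem_insert, ha, Finset.mem_filter, Finset.mem_erase, Finset.mem_univ,
          MulAction.mem_stabilizer_iff, false_or, true_and, not_false_eq_true, ne_eq, and_true]
        constructor
        · rintro rfl; exact hf a ha
        · intro h; exact (hfu a ha w h).symm
    rw [← Finset.card_insert_of_notMem (a := (1 : A)) (by simp), this, Nat.card_eq_fintype_card,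
      Fintype.card_subtype]
  have sum_le : ∀ S : Finset Ω, ∑ w ∈ S, Nat.card (MulAction.stabilizer A w) =
      {a ∈ (Finset.univ.erase (1 : A)) | f a ∈ S}.card + S.card := by
    intro S
    have h := Finset.card_eq_sum_card_fiberwise (s := {a ∈ (Finset.univ.erase (1 : A)) | f a ∈ S})
      (t := S) (f := f) (by intro a ha; simpa using (Finset.mem_filter.mp ha).2)
    rw [h, Finset.card_eq_sum_ones, ← Finset.sum_add_distrib]
    refine Finset.sum_congr rfl fun w hw => ?_
    rw [← fib w, Finset.filter_filter]
    congr 2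
    ext a
    simp only [Finset.mem_filter]
    constructor
    · rintro ⟨h1, rfl⟩; exact ⟨h1, hw, rfl⟩
    · rintro ⟨h1, -, h2⟩; exact ⟨h1, h2⟩
  have orb : ∀ w : Ω, ∑ v ∈ (MulAction.orbit A w).toFinset, Nat.card (MulAction.stabilizer A v) =
      Nat.card A := by
    intro w
    rw [Finset.sum_congr rfl (g := fun _ => Nat.card (MulAction.stabilizer A w))]
    · have := MulAction.card_orbit_mul_card_stabilizer_eq_card_group A w
      rw [Finset.sum_const, Set.toFinset_card, smul_eq_mul, Nat.card_eq_fintype_card,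
        Nat.card_eq_fintype_card]
      exact this
    · intro v hv
      rw [Set.mem_toFinset] at hv
      obtain ⟨g, rfl⟩ := hv
      exact (Nat.card_congr (MulAction.stabilizerEquivStabilizer rfl).toEquiv).symm
  have half : ∀ a : A, a ≠ 1 → 2 * (MulAction.orbit A (f a)).toFinset.card ≤ Nat.card A := by
    intro a ha
    have := MulAction.card_orbit_mul_card_stabilizer_eq_card_group A (f a)
    rw [← Set.toFinset_card, ← Nat.card_eq_fintype_card, ← Nat.card_eq_fintype_card] at this
    rw [← this, mul_comm]
    refine Nat.mul_le_mul_left _ ?_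
    have : Nontrivial (MulAction.stabilizer A (f a)) :=
      ⟨⟨⟨a, hf a ha⟩, 1, fun h => ha (congrArg Subtype.val h)⟩⟩
    exact Finite.one_lt_card
  have card_univ : (Finset.univ.erase (1 : A)).card + 1 = Nat.card A := by
    rw [Finset.card_erase_of_mem (Finset.mem_univ _), Nat.card_eq_fintype_card, Finset.card_univ]
    have : 0 < Fintype.card A := Fintype.card_pos
    omega
  -- Two distinct orbits with nontrivial stabilizers would give `2|A| ≤ (|A| - 1) + |A|`, each orbit
  -- having at most `|A|/2` points.
  have same : ∀ a b : A, a ≠ 1 → b ≠ 1 → f b ∈ MulAction.orbit A (f a) := by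
    intro a b ha hb
    by_contra hab
    have hdis : Disjoint (MulAction.orbit A (f a)).toFinset (MulAction.orbit A (f b)).toFinset := by
      rw [Set.disjoint_toFinset]
      refine (MulAction.orbit.eq_or_disjoint (f a) (f b)).resolve_left fun h => hab ?_
      rw [h]; exact MulAction.mem_orbit_self _
    have h := sum_le ((MulAction.orbit A (f a)).toFinset ∪ (MulAction.orbit A (f b)).toFinset)
    rw [Finset.sum_union hdis, orb, orb, Finset.card_union_of_disjoint hdis] at h
    have h3 := Finset.card_le_card (Finset.filter_subset (fun a' => f a' ∈
      (MulAction.orbit A (f a)).toFinset ∪ (MulAction.orbit A (f b)).toFinset)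
        (Finset.univ.erase (1 : A)))
    have h4 := half a ha
    have h5 := half b hb
    omega
  -- With all fixed points in one orbit `O`, the count reads `|A| = (|A| - 1) + |O|`.
  have one : (MulAction.orbit A (f a₀)).toFinset.card = 1 := by
    have h := sum_le (MulAction.orbit A (f a₀)).toFinset
    rw [orb, Finset.filter_true_of_mem] at h
    · omega
    · intro b hb
      rw [Set.mem_toFinset]
      exact same _ _ ha₀ (Finset.ne_of_mem_erase hb)
  obtain ⟨w, hw⟩ := Finset.card_eq_one.mp one
  have e₀ : f a₀ ∈ (MulAction.orbit A (f a₀)).toFinset := by simp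
  have e₁ : f a₁ ∈ (MulAction.orbit A (f a₀)).toFinset := by
    rw [Set.mem_toFinset]; exact same _ _ ha₀ ha₁
  rw [hw, Finset.mem_singleton] at e₀ e₁
  rw [hfu a₀ ha₀ w₀ h₀, hfu a₁ ha₁ w₁ h₁, e₀, e₁]

end Counting

/-! ### Fixed-point-free conjugation and Frobenius actions -/

section FixedPointFree

variable {X : Type*} [Group X]

/-- Fixed-point-freeness makes `a ↦ a⁻¹ aʰ` injective, hence surjective on a finite group. -/
theorem exists_eq_inv_mul_conj (D : Subgroup X) [Finite D] {h : X}
    (hD : ∀ a ∈ D, h * a * h⁻¹ ∈ D) (hfix : ∀ a ∈ D, h * a * h⁻¹ = a → a = 1) {b : X}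
    (hb : b ∈ D) : ∃ a ∈ D, b = a⁻¹ * (h * a * h⁻¹) := by
  let f : D → D := fun a => ⟨(a : X)⁻¹ * (h * a * h⁻¹), D.mul_mem (D.inv_mem a.2) (hD a a.2)⟩
  have hf : Function.Injective f := by
    intro a c hac
    have h1 : (a : X)⁻¹ * (h * a * h⁻¹) = (c : X)⁻¹ * (h * c * h⁻¹) := congrArg Subtype.val hac
    have h2 := hfix (c * (a : X)⁻¹) (D.mul_mem c.2 (D.inv_mem a.2)) (by
      have : h * c * h⁻¹ = c * ((a : X)⁻¹ * (h * a * h⁻¹)) := by rw [h1]; group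
      calc h * (c * (a : X)⁻¹) * h⁻¹ = (h * c * h⁻¹) * (h * a * h⁻¹)⁻¹ := by group
        _ = c * (a : X)⁻¹ := by rw [this]; group)
    exact (Subtype.ext (mul_inv_eq_one.mp h2)).symm
  obtain ⟨a, ha⟩ := Finite.surjective_of_injective hf ⟨b, hb⟩
  exact ⟨a, a.2, (congrArg Subtype.val ha).symm⟩

/-- In a permutation representation of a Frobenius group with kernel `K` and complement `H`, at
most one point of a `K`-orbit has a nontrivial stabilizer in `H`. -/
theorem smul_eq_of_fixed {Ω : Type*} [MulAction X Ω] (K H : Subgroup X) [Finite K] [Finite H]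
    (hHK : ∀ h ∈ H, ∀ a ∈ K, h * a * h⁻¹ ∈ K)
    (hfix : ∀ h ∈ H, h ≠ 1 → ∀ a ∈ K, h * a * h⁻¹ = a → a = 1) {ω : Ω} {h₀ h₁ a : X}
    (hh₀ : h₀ ∈ H) (hh₀1 : h₀ ≠ 1) (h₀ω : h₀ • ω = ω) (ha : a ∈ K)
    (hh₁ : h₁ ∈ H) (hh₁1 : h₁ ≠ 1) (h₁ω : h₁ • a • ω = a • ω) : a • ω = ω := by
  have key : ∀ h a : X, h • a • ω = (h * a * h⁻¹) • h • ω := fun h a => by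
    simp only [smul_smul]; congr 1; group
  -- The setwise stabilizer in `H` of the orbit `Kω`; each of its nonidentity elements will be shown
  -- to fix exactly one point there.
  let H₁ : Subgroup X :=
    { carrier := {h | h ∈ H ∧ ∃ a ∈ K, h • ω = a • ω}
      one_mem' := ⟨H.one_mem, 1, K.one_mem, rfl⟩
      mul_mem' := by
        rintro g h ⟨hg, a, ha, hga⟩ ⟨hh, b, hb, hhb⟩
        refine ⟨H.mul_mem hg hh, g * b * g⁻¹ * a, K.mul_mem (hHK g hg b hb) ha, ?_⟩
        rw [mul_smul, hhb, key, hga, mul_smul _ a]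
      inv_mem' := by
        rintro g ⟨hg, a, ha, hga⟩
        refine ⟨H.inv_mem hg, g⁻¹ * a⁻¹ * g, ?_, ?_⟩
        · simpa using hHK g⁻¹ (H.inv_mem hg) a⁻¹ (K.inv_mem ha)
        · rw [mul_smul, hga, mul_smul, inv_smul_smul] }
  have : Finite H₁ := Finite.Set.subset (H : Set X) fun h hh => hh.1
  let Ω₁ := {w : Ω // ∃ a ∈ K, w = a • ω}
  have : Finite Ω₁ := by
    refine Finite.of_surjective (fun a : K => (⟨(a : X) • ω, a, a.2, rfl⟩ : Ω₁)) ?_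
    rintro ⟨w, a, ha, rfl⟩
    exact ⟨⟨a, ha⟩, rfl⟩
  let act : MulAction H₁ Ω₁ :=
    { smul := fun h w => ⟨(h : X) • (w : Ω), by
        obtain ⟨h, hh, b, hb, hhb⟩ := h
        obtain ⟨w, a, ha, rfl⟩ := w
        exact ⟨h * a * h⁻¹ * b, K.mul_mem (hHK h hh a ha) hb, by
          rw [mul_smul _ b]; exact (key h a).trans (congrArg _ hhb)⟩⟩
      one_smul := fun w => Subtype.ext (one_smul X (w : Ω))
      mul_smul := fun g h w => Subtype.ext (mul_smul (g : X) (h : X) (w : Ω)) }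
  have m₀ : h₀ ∈ H₁ := ⟨hh₀, 1, K.one_mem, by rw [h₀ω, one_smul]⟩
  have m₁ : h₁ ∈ H₁ := by
    refine ⟨hh₁, (h₁ * a * h₁⁻¹)⁻¹ * a, K.mul_mem (K.inv_mem (hHK _ hh₁ _ ha)) ha, ?_⟩
    rw [mul_smul, ← h₁ω, key, inv_smul_smul]
  have hu : ∀ h : H₁, h ≠ 1 → ∃! w : Ω₁, h • w = w := by
    rintro ⟨h, hh, b, hb, hhb⟩ hne
    have hne : h ≠ 1 := fun e => hne (Subtype.ext e)
    obtain ⟨c, hc, hbc⟩ := exists_eq_inv_mul_conj K (hHK h hh) (hfix h hh hne) (K.inv_mem hb)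
    have hcω : h • c • ω = c • ω := by
      have : h * c * h⁻¹ = c * b⁻¹ := by rw [hbc]; group
      rw [key, this, hhb, mul_smul, inv_smul_smul]
    refine ⟨⟨c • ω, c, hc, rfl⟩, Subtype.ext hcω, ?_⟩
    rintro ⟨w, d, hd, rfl⟩ hw
    have hw : h • d • ω = d • ω := congrArg Subtype.val hw
    refine Subtype.ext ?_
    change d • ω = c • ω
    -- Uniqueness: `u = d c⁻¹` satisfies `u⁻¹ uʰ ∈ S`. Solving `u⁻¹ uʰ = s⁻¹ sʰ` inside the
    -- `h`-invariant group `S` makes `u s⁻¹` fixed by `h`, so `u = s`.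
    let S : Subgroup X := K ⊓ MulAction.stabilizer X (c • ω)
    have : Finite S := Finite.Set.subset (K : Set X) fun x hx => hx.1
    have hS : ∀ s ∈ S, h * s * h⁻¹ ∈ S := by
      rintro s ⟨hsK, hs⟩
      refine ⟨hHK h hh s hsK, ?_⟩
      have hs : s • c • ω = c • ω := hs
      change (h * s * h⁻¹) • c • ω = c • ω
      have : h⁻¹ • c • ω = c • ω := by rw [inv_smul_eq_iff, hcω]
      rw [mul_smul, mul_smul, this, hs, hcω]
    have hdc : d * c⁻¹ ∈ K := K.mul_mem hd (K.inv_mem hc)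
    have hmem : (d * c⁻¹)⁻¹ * (h * (d * c⁻¹) * h⁻¹) ∈ S := by
      refine ⟨K.mul_mem (K.inv_mem hdc) (hHK h hh _ hdc), ?_⟩
      change ((d * c⁻¹)⁻¹ * (h * (d * c⁻¹) * h⁻¹)) • c • ω = c • ω
      have e1 : h⁻¹ • c • ω = c • ω := by rw [inv_smul_eq_iff, hcω]
      rw [mul_smul, mul_smul, mul_smul, e1, mul_smul d, inv_smul_smul, hw, mul_inv_rev, inv_inv,
        mul_smul, inv_smul_smul]
    obtain ⟨s, hs, hse⟩ := exists_eq_inv_mul_conj S hS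
      (fun s hs => hfix h hh hne s hs.1) hmem
    have hfx := hfix h hh hne (d * c⁻¹ * s⁻¹) (K.mul_mem hdc (K.inv_mem hs.1)) (by
      have : h * (d * c⁻¹) * h⁻¹ = (d * c⁻¹) * (s⁻¹ * (h * s * h⁻¹)) := by rw [← hse]; group
      calc h * (d * c⁻¹ * s⁻¹) * h⁻¹ = (h * (d * c⁻¹) * h⁻¹) * (h * s * h⁻¹)⁻¹ := by group
        _ = _ := by rw [this]; group)
    have hds : d * c⁻¹ = s := mul_inv_eq_one.mp hfx
    have hsω : s • c • ω = c • ω := hs.2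
    rw [← hds, mul_smul, inv_smul_smul] at hsω
    exact hsω
  have := eq_of_existsUnique_fixed hu (a₀ := ⟨h₀, m₀⟩) (a₁ := ⟨h₁, m₁⟩)
    (fun e => hh₀1 (congrArg Subtype.val e)) (fun e => hh₁1 (congrArg Subtype.val e))
    (w₀ := ⟨ω, 1, K.one_mem, (one_smul X ω).symm⟩) (w₁ := ⟨a • ω, a, ha, rfl⟩)
    (Subtype.ext h₀ω) (Subtype.ext h₁ω)
  exact (congrArg Subtype.val this).symm

end FixedPointFree

/-! ### Coprime nonabelian cohomology -/

section Cocycle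

/-- Averaging in the abelianization: the product of all values of `f` has a `|K|`-th root there by
coprimality, and that root splits the cocycle. This is the inductive step down the derived series.
-/
theorem exists_cocycle_mem_commutator {K C : Type*} [Group K] [Finite K] [Group C] [Finite C]
    [MulDistribMulAction K C] (hcop : (Nat.card K).Coprime (Nat.card C)) (f : K → C)
    (hf : ∀ a b, f (a * b) = f a * a • f b) :
    ∃ c : C, ∀ a, c⁻¹ * f a * a • c ∈ commutator C := by
  have := Fintype.ofFinite K
  let π : C →* Abelianization C := Abelianization.of
  let α : K → Abelianization C →* Abelianization C := fun a =>
    Abelianization.map (MulDistribMulAction.toMonoidHom C a)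
  have hα : ∀ a c, α a (π c) = π (a • c) := fun a c => Abelianization.map_of _ _
  have hcard : (Nat.card (Abelianization C)).Coprime (Nat.card K) :=
    Nat.Coprime.coprime_dvd_left (Subgroup.card_quotient_dvd_card _) hcop.symm
  obtain ⟨e, he⟩ := (powCoprime hcard).surjective (∏ l, π (f l))
  have he : e ^ Nat.card K = ∏ l, π (f l) := he
  obtain ⟨c, rfl⟩ : ∃ c, π c = e := QuotientGroup.mk_surjective e
  refine ⟨c, fun a => ?_⟩
  have h1 : ∏ l, π (f l) = π (f a) ^ Nat.card K * α a (∏ l, π (f l)) := by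
    rw [map_prod, ← Fintype.prod_equiv (Equiv.mulLeft a) (fun l => π (f (a * l)))
      (fun l => π (f l)) (fun _ => rfl), Nat.card_eq_fintype_card, ← Finset.card_univ,
      ← Finset.prod_const, ← Finset.prod_mul_distrib]
    exact Finset.prod_congr rfl fun l _ => by rw [hf, map_mul, hα]
  have h2 : π (f a) * π (a • c) = π c := by
    apply (powCoprime hcard).injective
    change (π (f a) * π (a • c)) ^ Nat.card K = π c ^ Nat.card K
    rw [mul_pow, ← hα, ← map_pow (α a), he]
    exact h1.symm
  rw [← QuotientGroup.eq_one_iff]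
  change π (c⁻¹ * f a * a • c) = 1
  rw [map_mul, map_mul, mul_assoc, h2, map_inv, inv_mul_cancel]

/-- Vanishing of nonabelian `H¹` for a coprime action on a finite solvable group. -/
theorem exists_cocycle_trivial {K : Type*} [Group K] [Finite K] {C : Type*} [Group C] [Finite C]
    [Group.IsSolvable C] [MulDistribMulAction K C] (hcop : (Nat.card K).Coprime (Nat.card C))
    (f : K → C) (hf : ∀ a b, f (a * b) = f a * a • f b) : ∃ c : C, ∀ a, f a * a • c = c := by
  induction hn : Nat.card C using Nat.strong_induction_on generalizing C with
  | _ n ih =>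
    subst hn
    rcases subsingleton_or_nontrivial C with hC | hC
    · exact ⟨1, fun a => Subsingleton.elim _ _⟩
    obtain ⟨c, hc⟩ := exists_cocycle_mem_commutator hcop f hf
    have hsmul : ∀ (a : K), ∀ d ∈ commutator C, a • d ∈ commutator C := by
      intro a d hd
      have : (commutator C).map (MulDistribMulAction.toMonoidHom C a) ≤ commutator C := by
        rw [commutator_def, Subgroup.map_commutator]
        exact Subgroup.commutator_mono le_top le_top
      exact this ⟨d, hd, rfl⟩
    let act : MulDistribMulAction K (commutator C) :=
      { smul := fun a d => ⟨a • (d : C), hsmul a d d.2⟩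
        one_smul := fun d => Subtype.ext (one_smul K (d : C))
        mul_smul := fun a b d => Subtype.ext (mul_smul a b (d : C))
        smul_mul := fun a d e => Subtype.ext (smul_mul' a (d : C) (e : C))
        smul_one := fun a => Subtype.ext (smul_one a) }
    have hval : ∀ (a : K) (d : commutator C), ((a • d : commutator C) : C) = a • (d : C) :=
      fun _ _ => rfl
    have hlt : Nat.card (commutator C) < Nat.card C := by
      refine lt_of_le_of_ne (Subgroup.card_le_card_group _) fun h => ?_
      exact (Group.IsSolvable.commutator_lt_top_of_nontrivial C).ne
        (Subgroup.eq_top_of_card_eq _ h)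
    obtain ⟨d, hd⟩ := ih _ hlt
      (Nat.Coprime.coprime_dvd_right (Subgroup.card_subgroup_dvd_card _) hcop)
      (fun a => ⟨c⁻¹ * f a * a • c, hc a⟩) (by
        intro a b
        refine Subtype.ext ?_
        simp only [Subgroup.coe_mul, hval, hf, mul_smul, smul_mul', smul_inv']
        group) rfl
    refine ⟨c * d, fun a => ?_⟩
    have := congrArg Subtype.val (hd a)
    simp only [Subgroup.coe_mul, hval] at this
    rw [smul_mul']
    calc f a * (a • c * a • (d : C)) = c * (c⁻¹ * f a * a • c * a • (d : C)) := by group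
      _ = c * d := by rw [this]

/-- Coprime action: a coset `tC` that is invariant under conjugation by `K` contains an element
centralized by `K`. -/
theorem exists_commute_of_coprime {X : Type*} [Group X] (K C : Subgroup X) [Finite K] [Finite C]
    [Group.IsSolvable C] (hcop : (Nat.card K).Coprime (Nat.card C))
    (hKC : ∀ a ∈ K, ∀ c ∈ C, a * c * a⁻¹ ∈ C) (t : X)
    (ht : ∀ a ∈ K, t⁻¹ * (a * t * a⁻¹) ∈ C) : ∃ c ∈ C, ∀ a ∈ K, a * (t * c) = t * c * a := by
  let act : MulDistribMulAction K C :=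
    { smul := fun a d => ⟨a * d * (a : X)⁻¹, hKC a a.2 d d.2⟩
      one_smul := fun d => Subtype.ext (by change (1 : X) * d * (1 : X)⁻¹ = d; simp)
      mul_smul := fun a b d => Subtype.ext (by
        change (a * b : X) * d * (a * b : X)⁻¹ = a * (b * d * (b : X)⁻¹) * (a : X)⁻¹; group)
      smul_mul := fun a d e => Subtype.ext (by
        change (a : X) * (d * e) * (a : X)⁻¹ = a * d * (a : X)⁻¹ * (a * e * (a : X)⁻¹); group)
      smul_one := fun a => Subtype.ext (by change (a : X) * 1 * (a : X)⁻¹ = 1; simp) }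
  have hval : ∀ (a : K) (d : C), ((a • d : C) : X) = a * d * (a : X)⁻¹ := fun _ _ => rfl
  obtain ⟨c, hc⟩ := exists_cocycle_trivial hcop
    (fun a : K => (⟨t⁻¹ * (a * t * (a : X)⁻¹), ht a a.2⟩ : C)) (by
      intro a b
      refine Subtype.ext ?_
      simp only [Subgroup.coe_mul, hval]
      group)
  refine ⟨c, c.2, fun a ha => ?_⟩
  have := congrArg Subtype.val (hc ⟨a, ha⟩)
  simp only [Subgroup.coe_mul, hval] at this
  calc a * (t * c) = t * (t⁻¹ * (a * t * a⁻¹) * (a * c * a⁻¹)) * a := by group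
    _ = t * c * a := by rw [this]

end Cocycle

/-! ### Splitting a nilpotent group into its `q'`-part and `q`-part -/

section Nilpotent

/-- In the product of Sylow subgroups, at each prime one of the two components is trivial. -/
theorem commute_of_coprime_orderOf {T : Type*} [Group T] [Finite T] [Group.IsNilpotent T]
    {g h : T} (hgh : (orderOf g).Coprime (orderOf h)) : Commute g h := by
  obtain ⟨e⟩ := ((Group.isNilpotent_of_finite_tfae (G := T)).out 0 4).mp
    (inferInstance : Group.IsNilpotent T)
  suffices Commute (e.symm g) (e.symm h) by simpa using this.map e
  rw [← e.symm.orderOf_eq g, ← e.symm.orderOf_eq h] at hgh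
  refine funext fun r => funext fun P => ?_
  have : Fact (r : ℕ).Prime := ⟨Nat.prime_of_mem_primeFactors r.2⟩
  set u := e.symm g
  set v := e.symm h
  obtain ⟨m, hm⟩ := (IsPGroup.iff_orderOf.mp P.isPGroup') (u r P)
  obtain ⟨n, hn⟩ := (IsPGroup.iff_orderOf.mp P.isPGroup') (v r P)
  have hu : orderOf (u r P) ∣ orderOf u := orderOf_dvd_of_pow_eq_one (by
    rw [← Pi.pow_apply, ← Pi.pow_apply, pow_orderOf_eq_one]; rfl)
  have hv : orderOf (v r P) ∣ orderOf v := orderOf_dvd_of_pow_eq_one (by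
    rw [← Pi.pow_apply, ← Pi.pow_apply, pow_orderOf_eq_one]; rfl)
  have hco := Nat.Coprime.coprime_dvd_right hv (Nat.Coprime.coprime_dvd_left hu hgh)
  rw [Pi.mul_apply, Pi.mul_apply, Pi.mul_apply, Pi.mul_apply]
  rw [hm, hn] at hco
  rcases Nat.eq_zero_or_pos m with rfl | hmp
  · rw [pow_zero, orderOf_eq_one_iff] at hm
    rw [hm, one_mul, mul_one]
  rcases Nat.eq_zero_or_pos n with rfl | hnp
  · rw [pow_zero, orderOf_eq_one_iff] at hn
    rw [hn, one_mul, mul_one]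
  · rw [Nat.coprime_pow_left_iff hmp, Nat.coprime_pow_right_iff hnp, Nat.coprime_self] at hco
    exact absurd hco (Nat.Prime.one_lt Fact.out).ne'

/-- A finite nilpotent group is the direct product of its `q`-part `P` and its `q'`-part `K`. -/
theorem exists_coprime_decomposition {G : Type*} [Group G] [Finite G] (F : Subgroup G)
    [Group.IsNilpotent F] {q : ℕ} (hq : q.Prime) :
    ∃ K P : Subgroup G, K ≤ F ∧ P ≤ F ∧ (Nat.card K).Coprime q ∧ IsPGroup q P ∧
      (∀ a ∈ K, ∀ b ∈ P, a * b = b * a) ∧ (∀ f ∈ F, ∃ a ∈ K, ∃ b ∈ P, f = a * b) ∧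
      (∀ f ∈ F, f ∈ K ↔ (orderOf f).Coprime q) ∧
      (∀ f ∈ F, (∃ n, orderOf f = q ^ n) → f ∈ P) := by
  have : Fact q.Prime := ⟨hq⟩
  let S : Sylow q F := default
  obtain ⟨L, hL⟩ := Subgroup.exists_right_complement'_of_coprime (N := (S : Subgroup F))
    S.card_coprime_index
  have hcardL : (Nat.card L).Coprime q := by
    rw [← hL.symm.index_eq_card]
    exact ((hq.coprime_iff_not_dvd).mpr S.not_dvd_index).symm
  have hcomm : ∀ a ∈ L, ∀ b ∈ (S : Subgroup F), a * b = b * a := by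
    intro a ha b hb
    refine commute_of_coprime_orderOf ?_
    obtain ⟨n, hn⟩ := (IsPGroup.iff_orderOf.mp S.isPGroup') ⟨b, hb⟩
    rw [Subgroup.orderOf_mk] at hn
    rw [hn]
    refine Nat.Coprime.pow_right _ (Nat.Coprime.coprime_dvd_left ?_ hcardL)
    rw [← Subgroup.orderOf_mk a ha]
    exact orderOf_dvd_natCard _
  have hdec : ∀ f : F, ∃ a ∈ L, ∃ b ∈ (S : Subgroup F), f = a * b := by
    intro f
    obtain ⟨⟨b, a⟩, hba⟩ := hL.2 f
    exact ⟨a, a.2, b, b.2, by rw [hcomm a a.2 b b.2]; exact hba.symm⟩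
  refine ⟨L.map F.subtype, (S : Subgroup F).map F.subtype, Subgroup.map_subtype_le _,
    Subgroup.map_subtype_le _, ?_, S.isPGroup'.map _, ?_, ?_, ?_, ?_⟩
  · rwa [Subgroup.card_map_of_injective F.subtype_injective]
  · rintro _ ⟨a, ha, rfl⟩ _ ⟨b, hb, rfl⟩
    exact congrArg Subtype.val (hcomm a ha b hb)
  · intro f hf
    obtain ⟨a, ha, b, hb, hab⟩ := hdec ⟨f, hf⟩
    exact ⟨a, ⟨a, ha, rfl⟩, b, ⟨b, hb, rfl⟩, congrArg Subtype.val hab⟩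
  · intro f hf
    constructor
    · rintro ⟨a, ha, rfl⟩
      rw [Subgroup.subtype_apply, Subgroup.orderOf_coe]
      refine Nat.Coprime.coprime_dvd_left ?_ hcardL
      rw [← Subgroup.orderOf_mk a ha]
      exact orderOf_dvd_natCard _
    · intro hco
      obtain ⟨a, ha, b, hb, hab⟩ := hdec ⟨f, hf⟩
      suffices b = 1 by
        rw [this, mul_one] at hab
        exact ⟨a, ha, (congrArg Subtype.val hab).symm⟩
      obtain ⟨n, hn⟩ := (IsPGroup.iff_orderOf.mp S.isPGroup') ⟨b, hb⟩
      rw [Subgroup.orderOf_mk] at hn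
      have h1 : orderOf b ∣ Nat.card L * orderOf f := by
        refine orderOf_dvd_of_pow_eq_one ?_
        have haL : a ^ Nat.card L = 1 := by
          have := pow_card_eq_one' (x := (⟨a, ha⟩ : L))
          exact congrArg Subtype.val this
        have h2 : (⟨f, hf⟩ : F) ^ (Nat.card L * orderOf f) = 1 := by
          rw [mul_comm, pow_mul]
          have : (⟨f, hf⟩ : F) ^ orderOf f = 1 := Subtype.ext (pow_orderOf_eq_one f)
          rw [this, one_pow]
        rw [hab, (show Commute a b from hcomm a ha b hb).mul_pow, pow_mul a, haL, one_pow,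
          one_mul] at h2
        exact h2
      have h3 : (orderOf b).Coprime (Nat.card L * orderOf f) := by
        rw [hn]
        exact Nat.Coprime.pow_left _ (Nat.Coprime.mul_right hcardL.symm hco.symm)
      rw [← orderOf_eq_one_iff]
      exact Nat.Coprime.eq_one_of_dvd h3 h1
  · rintro f hf ⟨n, hn⟩
    obtain ⟨a, ha, b, hb, hab⟩ := hdec ⟨f, hf⟩
    suffices a = 1 by
      rw [this, one_mul] at hab
      exact ⟨b, hb, (congrArg Subtype.val hab).symm⟩
    obtain ⟨m, hm⟩ := (IsPGroup.iff_orderOf.mp S.isPGroup') ⟨b, hb⟩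
    rw [Subgroup.orderOf_mk] at hm
    have h1 : orderOf a ∣ q ^ (m + n) := by
      refine orderOf_dvd_of_pow_eq_one ?_
      have h2 : (⟨f, hf⟩ : F) ^ (q ^ (m + n)) = 1 := by
        refine Subtype.ext ?_
        change f ^ (q ^ (m + n)) = 1
        rw [pow_add, mul_comm, pow_mul, ← hn, pow_orderOf_eq_one, one_pow]
      rw [hab, (show Commute a b from hcomm a ha b hb).mul_pow, pow_add q, pow_mul b, ← hm,
        pow_orderOf_eq_one, one_pow, mul_one] at h2
      rw [pow_add q, ← hm]
      exact h2
    have h3 : (orderOf a).Coprime (q ^ (m + n)) := by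
      refine Nat.Coprime.pow_right _ (Nat.Coprime.coprime_dvd_left ?_ hcardL)
      rw [← Subgroup.orderOf_mk a ha]
      exact orderOf_dvd_natCard _
    rw [← orderOf_eq_one_iff]
    exact Nat.Coprime.eq_one_of_dvd h3 h1

end Nilpotent

/-! ### Centralizers of the `q'`-part of a Carter subgroup -/

section Carter

/-- The centralizer in a normal `q`-subgroup of the `q'`-part of a Carter subgroup `F` is contained
in `F`. -/
theorem IsCarter.mem_of_commute {G : Type*} [Group G] [Finite G] {F : Subgroup G}
    (hF : IsCarter F) {q : ℕ} (hq : q.Prime) {K P Q : Subgroup G} (hKF : K ≤ F) (hPF : P ≤ F)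
    (hP : IsPGroup q P) (hKP : ∀ a ∈ K, ∀ b ∈ P, a * b = b * a)
    (hdec : ∀ f ∈ F, ∃ a ∈ K, ∃ b ∈ P, f = a * b)
    (hmem : ∀ f ∈ F, (∃ n, orderOf f = q ^ n) → f ∈ P)
    (hQ : IsPGroup q Q) [Q.Normal] {y : G} (hy : y ∈ Q) (hyK : ∀ a ∈ K, a * y = y * a) :
    y ∈ F := by
  have : Fact q.Prime := ⟨hq⟩
  let D : Subgroup G := Q ⊓ Subgroup.centralizer (K : Set G)
  have hPD : P ≤ Subgroup.normalizer (D : Set G) := by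
    intro b hb
    refine Subgroup.mem_normalizer_fintype fun d hd => ⟨Subgroup.Normal.conj_mem ‹_› d hd.1 b, ?_⟩
    refine Subgroup.mem_centralizer_iff.mpr fun a ha => ?_
    have h1 : a * d = d * a := Subgroup.mem_centralizer_iff.mp hd.2 a ha
    have h2 : a * b = b * a := hKP a ha b hb
    have h3 : a * b⁻¹ = b⁻¹ * a := hKP a ha b⁻¹ (P.inv_mem hb)
    rw [← mul_assoc, ← mul_assoc, h2, mul_assoc b, h1, mul_assoc, mul_assoc, h3]
    group
  have hR : IsPGroup q (P ⊔ D : Subgroup G) :=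
    IsPGroup.to_sup_of_normal_right' hP (hQ.to_le inf_le_left) hPD
  have hRK : P ⊔ D ≤ Subgroup.centralizer (K : Set G) := by
    refine sup_le (fun b hb => ?_) inf_le_right
    rw [Subgroup.mem_centralizer_iff]
    exact fun a ha => hKP a ha b hb
  -- Otherwise `P` is proper in the `q`-group `PD`, so its normalizer there is larger. Since `PD`
  -- centralizes `K`, that normalizer normalizes `KP = F`, hence lies in `F`, and its elements,
  -- being `q`-elements, lie in `P`.
  by_contra hyF
  have hlt : P.subgroupOf (P ⊔ D) < ⊤ := by
    rw [lt_top_iff_ne_top, Ne, Subgroup.subgroupOf_eq_top]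
    intro h
    exact hyF (hPF (h (Subgroup.mem_sup_right ⟨hy,
      Subgroup.mem_centralizer_iff.mpr hyK⟩)))
  have := hR.isNilpotent
  obtain ⟨g, hg, hgP⟩ := SetLike.exists_of_lt
    (Group.normalizerCondition_of_isNilpotent (G := (P ⊔ D : Subgroup G)) _ hlt)
  refine hgP (Subgroup.mem_subgroupOf.mpr ?_)
  have hgF : (g : G) ∈ F := by
    rw [← hF.normalizer_eq]
    refine Subgroup.mem_normalizer_fintype fun f hf => ?_
    obtain ⟨a, ha, b, hb, rfl⟩ := hdec f hf
    have h1 : a * g = g * a := Subgroup.mem_centralizer_iff.mp (hRK g.2) a ha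
    have h2 := (Subgroup.mem_normalizer_iff.mp hg ⟨b, Subgroup.mem_sup_left hb⟩).mp
      (Subgroup.mem_subgroupOf.mpr hb)
    have h3 : (g : G) * b * (g : G)⁻¹ ∈ P := Subgroup.mem_subgroupOf.mp h2
    have h4 : (g : G) * (a * b) * (g : G)⁻¹ = a * (g * b * (g : G)⁻¹) := by
      rw [← mul_assoc (g : G) a, ← h1]; group
    rw [SetLike.mem_coe, h4]
    exact F.mul_mem (hKF ha) (hPF h3)
  obtain ⟨n, hn⟩ := IsPGroup.iff_orderOf.mp hR g
  exact hmem g hgF ⟨n, by rw [Subgroup.orderOf_coe, hn]⟩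

end Carter

/-! ### Idempotents permuted by a Frobenius group -/

section Ring

theorem sup_le_normalizer_closure_conj {X : Type*} [Group X] [Finite X] (K H : Subgroup X)
    (hHK : ∀ h ∈ H, ∀ a ∈ K, h * a * h⁻¹ ∈ K) {x : X} (hxH : ∀ h ∈ H, h * x = x * h) :
    K ⊔ H ≤ Subgroup.normalizer
      (Subgroup.closure {y | ∃ a ∈ K, y = a * x * a⁻¹} : Set X) := by
  set Q := Subgroup.closure {y | ∃ a ∈ K, y = a * x * a⁻¹} with hxQ
  have conjQ : ∀ g : X, (∀ a ∈ K, g * (a * x * a⁻¹) * g⁻¹ ∈ Q) →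
      g ∈ Subgroup.normalizer (Q : Set X) := by
    intro g hg
    refine Subgroup.mem_normalizer_fintype fun y hy => ?_
    have : Q ≤ Q.comap (MulAut.conj g).toMonoidHom := by
      conv_lhs => rw [hxQ]
      rw [Subgroup.closure_le]
      rintro _ ⟨a, ha, rfl⟩
      exact hg a ha
    exact this hy
  refine sup_le (fun g hg => conjQ g fun a ha => ?_) (fun g hg => conjQ g fun a ha => ?_)
  · exact Subgroup.subset_closure ⟨g * a, K.mul_mem hg ha, by group⟩
  · refine Subgroup.subset_closure ⟨g * a * g⁻¹, hHK g hg a ha, ?_⟩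
    have : g⁻¹ * x = x * g⁻¹ := hxH _ (H.inv_mem hg)
    calc g * (a * x * a⁻¹) * g⁻¹ = g * a * (x * g⁻¹) * g * a⁻¹ * g⁻¹ := by group
      _ = _ := by rw [← this]; group

variable {X k B : Type*} [Group X] [Field k] [Ring B] [Algebra k B]

/-- The action of a group on a ring by conjugation, through a homomorphism into the ring. -/
@[reducible] def conjAction (ρ : X →* B) : MulAction X B where
  smul g b := ρ g * b * ρ g⁻¹
  one_smul b := by change ρ 1 * b * ρ 1⁻¹ = b; simp
  mul_smul g h b := by
    change ρ (g * h) * b * ρ (g * h)⁻¹ = ρ g * (ρ h * b * ρ h⁻¹) * ρ g⁻¹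
    simp only [mul_inv_rev, map_mul, mul_assoc]

theorem map_mul_map_inv (ρ : X →* B) (g : X) : ρ g * ρ g⁻¹ = 1 := by
  rw [← map_mul, mul_inv_cancel, map_one]

theorem map_inv_mul_map (ρ : X →* B) (g : X) : ρ g⁻¹ * ρ g = 1 := by
  rw [← map_mul, inv_mul_cancel, map_one]

theorem map_conj_mul (ρ : X →* B) (a g : X) (f : B) :
    letI := conjAction ρ
    ρ (a * g * a⁻¹) * f = a • (ρ g * (a⁻¹ • f)) := by
  change _ = ρ a * (ρ g * (ρ a⁻¹ * f * ρ a⁻¹⁻¹)) * ρ a⁻¹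
  rw [inv_inv, map_mul, map_mul]
  simp only [mul_assoc]
  rw [map_mul_map_inv, mul_one]

theorem conjAction_smul (ρ : X →* B) (a : X) (d : k) (f : B) :
    letI := conjAction ρ
    a • (d • f) = d • (a • f) := by
  change ρ a * (d • f) * ρ a⁻¹ = d • (ρ a * f * ρ a⁻¹)
  rw [mul_smul_comm, smul_mul_assoc]

theorem map_inv_mul_of_eq (ρ : X →* B) {g : X} {f f' : B} (h : ρ g * f = f') :
    ρ g⁻¹ * f' = f := by
  rw [← h, ← mul_assoc, map_inv_mul_map, one_mul]

/-- If the sum over a group `H` annihilates `ρ x - 1` from the left, where `x` commutes with `H`,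
then `x` acts trivially on every idempotent which is orthogonal to its nontrivial
`H`-conjugates. -/
theorem map_mul_eq_of_regular (ρ : X →* B) (H : Subgroup X) [Fintype H] {x : X}
    (hN : (∑ h : H, ρ h) * (ρ x - 1) = 0) {f : B} (hf : f * f = f) (hfx : ρ x * f = f * ρ x)
    (horth : ∀ h ∈ H, h ≠ 1 → f * ρ h * f = 0) : ρ x * f = f := by
  have h1 : f * ((∑ h : H, ρ h) * (ρ x - 1)) * f = f * (ρ x - 1) := by
    have h2 : (ρ x - 1) * f = f * (ρ x - 1) := by rw [sub_mul, mul_sub, hfx, one_mul, mul_one]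
    rw [mul_assoc, mul_assoc, h2, ← mul_assoc, ← mul_assoc, Finset.mul_sum, Finset.sum_mul,
      Finset.sum_eq_single (1 : H)]
    · rw [Subgroup.coe_one, map_one, mul_one, hf]
    · intro h _ hne
      exact horth h h.2 fun e => hne (Subtype.ext e)
    · intro h; exact absurd (Finset.mem_univ _) h
  rw [hN, mul_zero, zero_mul, mul_sub, mul_one, ← hfx] at h1
  exact (sub_eq_zero.mp h1.symm)

/-- The heart of the proof. Were `x e ≠ e`, then `e` would be the only point of its `K`-orbit with a
nontrivial stabilizer in `H`, and `x` would be trivial on all the others. This independence allows a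
scalar on `e` to be spread over the whole orbit. -/
theorem map_mul_idempotent_eq [Finite X] (ρ : X →* B) {q : ℕ} (hq : q.Prime)
    (K H Q : Subgroup X) [Fintype H]
    (hHK : ∀ h ∈ H, ∀ a ∈ K, h * a * h⁻¹ ∈ K)
    (hfix : ∀ h ∈ H, h ≠ 1 → ∀ a ∈ K, h * a * h⁻¹ = a → a = 1)
    (hKq : (Nat.card K).Coprime q) {x : X} (hxH : ∀ h ∈ H, h * x = x * h)
    (hQ : IsPGroup q Q) (hxQ : Q = Subgroup.closure {y | ∃ a ∈ K, y = a * x * a⁻¹})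
    (hQfix : ∀ h ∈ H, h ≠ 1 → ∀ y ∈ Q, (∀ a ∈ K, a * y = y * a) → h * y * h⁻¹ = y → y = 1)
    (hN : (∑ h : H, ρ h) * (ρ x - 1) = 0)
    {e : B} (he : e * e = e) (heQ : ∀ y ∈ Q, ρ y * e = e * ρ y)
    (horth : ∀ g ∈ K ⊔ H, ρ g * e * ρ g⁻¹ = e ∨ ρ g * e * ρ g⁻¹ * e = 0)
    {z : X} (hz : z ∈ Q) {c : k} (hzc : ρ z * e = c • e) (hc : c ≠ 1) : ρ x * e = e := by
  classical
  have : Fact q.Prime := ⟨hq⟩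
  have := Fintype.ofFinite K
  let _ := conjAction ρ
  have hdef : ∀ (g : X) (b : B), g • b = ρ g * b * ρ g⁻¹ := fun _ _ => rfl
  have xmem : x ∈ Q := by
    rw [hxQ]; exact Subgroup.subset_closure ⟨1, K.one_mem, by group⟩
  have hnorm := sup_le_normalizer_closure_conj K H hHK hxH
  rw [← hxQ] at hnorm
  have KQ : ∀ g ∈ K, ∀ y ∈ Q, g * y * g⁻¹ ∈ Q := fun g hg y =>
    (Subgroup.mem_normalizer_iff.mp (hnorm (Subgroup.mem_sup_left hg)) y).mp
  have HQ : ∀ g ∈ H, ∀ y ∈ Q, g * y * g⁻¹ ∈ Q := fun g hg y =>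
    (Subgroup.mem_normalizer_iff.mp (hnorm (Subgroup.mem_sup_right hg)) y).mp
  have reg : ∀ a ∈ K, (∀ h ∈ H, h • a • e = a • e → h = 1) → ρ x * a • e = a • e := by
    intro a ha hreg
    refine map_mul_eq_of_regular ρ H hN ?_ ?_ ?_
    · rw [hdef]
      calc ρ a * e * ρ a⁻¹ * (ρ a * e * ρ a⁻¹) = ρ a * e * (ρ a⁻¹ * ρ a) * e * ρ a⁻¹ := by
            simp only [mul_assoc]
        _ = ρ a * (e * e) * ρ a⁻¹ := by rw [map_inv_mul_map]; simp only [mul_assoc, mul_one]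
        _ = _ := by rw [he]
    · have h1 := heQ _ (KQ a⁻¹ (K.inv_mem ha) x xmem)
      rw [inv_inv] at h1
      have h2 : ρ x * (ρ a * e * ρ a⁻¹) = ρ a * (ρ (a⁻¹ * x * a) * e) * ρ a⁻¹ := by
        rw [map_mul, map_mul]
        simp only [← mul_assoc]
        rw [map_mul_map_inv, one_mul]
      have h3 : ρ a * e * ρ a⁻¹ * ρ x = ρ a * (e * ρ (a⁻¹ * x * a)) * ρ a⁻¹ := by
        rw [map_mul, map_mul]
        simp only [mul_assoc]
        rw [map_mul_map_inv, mul_one]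
      rw [hdef, h2, h1, h3]
    · intro h hh hne
      have hmem : a⁻¹ * h⁻¹ * a ∈ K ⊔ H :=
        mul_mem (mul_mem (Subgroup.mem_sup_left (K.inv_mem ha))
          (Subgroup.mem_sup_right (H.inv_mem hh))) (Subgroup.mem_sup_left ha)
      rcases horth _ hmem with h1 | h1
      · exfalso
        rw [← hdef, mul_smul, mul_smul, inv_smul_eq_iff] at h1
        exact hne (inv_eq_one.mp (hreg h⁻¹ (H.inv_mem hh) h1))
      · have h2 : ρ (a⁻¹ * h⁻¹ * a)⁻¹ * (ρ (a⁻¹ * h⁻¹ * a) * e * ρ (a⁻¹ * h⁻¹ * a)⁻¹ * e) =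
            e * ρ (a⁻¹ * h⁻¹ * a)⁻¹ * e := by
          simp only [← mul_assoc]; rw [map_inv_mul_map, one_mul]
        rw [h1, mul_zero] at h2
        have h3 : (a⁻¹ * h⁻¹ * a)⁻¹ = a⁻¹ * h * a := by group
        rw [h3, map_mul, map_mul] at h2
        rw [hdef]
        calc ρ a * e * ρ a⁻¹ * ρ h * (ρ a * e * ρ a⁻¹) =
            ρ a * (e * (ρ a⁻¹ * ρ h * ρ a) * e) * ρ a⁻¹ := by simp only [mul_assoc]
          _ = 0 := by rw [← h2, mul_zero, zero_mul]
  by_contra hxe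
  have he0 : e ≠ 0 := by rintro rfl; exact hxe (mul_zero _)
  obtain ⟨h₀, hh₀, h₀e, hh₀1⟩ : ∃ h ∈ H, h • e = e ∧ h ≠ 1 := by
    by_contra! hno
    refine hxe ?_
    have := reg 1 K.one_mem (by rw [one_smul]; exact hno)
    rwa [one_smul] at this
  have triv : ∀ a ∈ K, a • e ≠ e → ρ x * a • e = a • e := by
    intro a ha hae
    refine reg a ha fun h hh hha => ?_
    by_contra hne
    exact hae (smul_eq_of_fixed K H hHK hfix hh₀ hh₀1 h₀e ha hh hne hha)
  let Q₁ : Subgroup X := Subgroup.closure {y | ∃ a ∈ K, a • e = e ∧ y = a * x * a⁻¹}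
  have Q₁Q : Q₁ ≤ Q := by
    rw [hxQ]
    refine Subgroup.closure_mono ?_
    rintro y ⟨a, ha, -, hy⟩
    exact ⟨a, ha, hy⟩
  have Q₁triv : ∀ y ∈ Q₁, ∀ b ∈ K, b • e ≠ e → ρ y * b • e = b • e := by
    intro y hy b hb hbe
    induction hy using Subgroup.closure_induction with
    | mem y hy =>
      obtain ⟨a, ha, hae, rfl⟩ := hy
      rw [map_conj_mul, ← mul_smul, triv (a⁻¹ * b) (K.mul_mem (K.inv_mem ha) hb), ← mul_smul,
        mul_inv_cancel_left]
      rw [mul_smul, Ne, inv_smul_eq_iff, hae]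
      exact hbe
    | one => rw [map_one, one_mul]
    | mul y y' _ _ h1 h2 => rw [map_mul, mul_assoc, h2, h1]
    | inv y _ h1 => exact map_inv_mul_of_eq ρ h1
  -- Generators `a x a⁻¹` with `a • e ≠ e` act trivially on `e`, so `Q₁` induces the same operators
  -- on `e` as `Q`.
  obtain ⟨y, hyQ₁, hye⟩ : ∃ y ∈ Q₁, ρ y * e = ρ z * e := by
    rw [hxQ] at hz
    clear hzc
    induction hz using Subgroup.closure_induction with
    | mem g hg =>
      obtain ⟨a, ha, rfl⟩ := hg
      by_cases hae : a • e = e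
      · exact ⟨_, Subgroup.subset_closure ⟨a, ha, hae, rfl⟩, rfl⟩
      · refine ⟨1, Q₁.one_mem, ?_⟩
        rw [map_conj_mul, triv _ (K.inv_mem ha), smul_inv_smul, map_one, one_mul]
        rw [Ne, inv_smul_eq_iff]
        exact fun h => hae h.symm
    | one => exact ⟨1, Q₁.one_mem, rfl⟩
    | mul g g' hg hg' h1 h2 =>
      obtain ⟨y, hy, hye⟩ := h1
      obtain ⟨y', hy', hye'⟩ := h2
      refine ⟨y * y', Q₁.mul_mem hy hy', ?_⟩
      rw [map_mul, map_mul, mul_assoc, mul_assoc, ← hye', heQ y' (Q₁Q hy'), ← mul_assoc,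
        ← mul_assoc, hye]
    | inv g hg h1 =>
      obtain ⟨y, hy, hye⟩ := h1
      refine ⟨y⁻¹, Q₁.inv_mem hy, ?_⟩
      rw [heQ _ (Q.inv_mem (Q₁Q hy))]
      refine (map_inv_mul_of_eq ρ ?_).symm
      rw [← mul_assoc, ← hye, heQ y (Q₁Q hy), mul_assoc, map_mul_map_inv, mul_one]
  rw [hzc] at hye
  have hyconj : ∀ a ∈ K, ∀ b ∈ K,
      ρ (a * y * a⁻¹) * b • e = (if a • e = b • e then c else 1) • b • e := by
    intro a ha b hb
    rw [map_conj_mul, ← mul_smul]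
    split_ifs with hab
    · have : (a⁻¹ * b) • e = e := by rw [mul_smul, ← hab, inv_smul_smul]
      rw [this, hye, conjAction_smul, hab]
    · rw [Q₁triv y hyQ₁ _ (K.mul_mem (K.inv_mem ha) hb), ← mul_smul, mul_inv_cancel_left, one_smul]
      rw [mul_smul, Ne, inv_smul_eq_iff]
      exact fun h => hab h.symm
  have hlist : ∀ (l : List K), ∀ b ∈ K,
      ρ (l.map fun a : K => (a : X) * y * (a : X)⁻¹).prod * b • e =
        (l.map fun a : K => if (a : X) • e = b • e then c else 1).prod • b • e := by
    intro l b hb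
    induction l with
    | nil => rw [List.map_nil, List.map_nil, List.prod_nil, List.prod_nil, map_one, one_mul, one_smul]
    | cons a l ih =>
      rw [List.map_cons, List.map_cons, List.prod_cons, List.prod_cons, map_mul, mul_assoc, ih,
        mul_smul_comm, hyconj a a.2 b hb, smul_smul, mul_comm]
  let S : Subgroup K := (MulAction.stabilizer X e).subgroupOf K
  let d : k := c ^ Nat.card S
  -- The factor indexed by `a` acts by `c` on `a • e` and trivially on the other translates, so each
  -- translate receives one `c` per element of a coset of `S`.
  let t : X := (Finset.univ.toList.map fun a : K => (a : X) * y * (a : X)⁻¹).prod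
  have htQ : t ∈ Q := by
    refine list_prod_mem fun g hg => ?_
    obtain ⟨a, -, rfl⟩ := List.mem_map.mp hg
    exact KQ a a.2 y (Q₁Q hyQ₁)
  have ht : ∀ b ∈ K, ρ t * b • e = d • b • e := by
    intro b hb
    rw [hlist _ b hb, Finset.prod_map_toList,
      ← Fintype.prod_equiv (Equiv.mulLeft (⟨b, hb⟩ : K)) (fun a : K => if (a : X) • e = e then c else 1)
        (fun a : K => if (a : X) • e = b • e then c else 1)]
    · rw [Finset.prod_ite, Finset.prod_const, Finset.prod_const_one, mul_one]
      congr 2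
      rw [Nat.card_eq_fintype_card, ← Fintype.card_subtype]
      exact Fintype.card_congr (Equiv.refl _)
    · intro a
      refine if_congr ?_ rfl rfl
      change (a : X) • e = e ↔ (b * a : X) • e = b • e
      rw [mul_smul, smul_left_cancel_iff]
  -- `c` has `q`-power order because `z` does, while `|S|` divides `|K|`, which is prime to `q`.
  have hd : d ≠ 1 := by
    intro hd
    obtain ⟨n, hn⟩ := hQ ⟨z, hz⟩
    have hn : z ^ q ^ n = 1 := congrArg Subtype.val hn
    have hpow : ∀ m : ℕ, ρ (z ^ m) * e = c ^ m • e := by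
      intro m
      induction m with
      | zero => rw [pow_zero, pow_zero, map_one, one_mul, one_smul]
      | succ m ih => rw [pow_succ, map_mul, mul_assoc, hzc, mul_smul_comm, ih, smul_smul, pow_succ']
    have h1 := hpow (q ^ n)
    rw [hn, map_one, one_mul] at h1
    have h2 : c ^ q ^ n = 1 := by
      have : (c ^ q ^ n - 1) • e = 0 := by rw [sub_smul, one_smul, ← h1, sub_self]
      exact sub_eq_zero.mp ((smul_eq_zero.mp this).resolve_right he0)
    have h3 : (Nat.card S).Coprime (q ^ n) := Nat.Coprime.pow_right _
      (Nat.Coprime.coprime_dvd_left (Subgroup.card_subgroup_dvd_card S) hKq)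
    have h4 : orderOf c ∣ 1 := by
      rw [← h3]
      exact Nat.dvd_gcd (orderOf_dvd_of_pow_eq_one hd) (orderOf_dvd_of_pow_eq_one h2)
    exact hc (orderOf_eq_one_iff.mp (Nat.dvd_one.mp h4))
  -- The elements of `Q` trivial on the whole `K`-orbit of `e`. Conjugates of `t` by `K` act by the
  -- same scalar `d`, so the coset `tC` is `K`-invariant.
  let C : Subgroup X :=
    { carrier := {g | g ∈ Q ∧ ∀ b ∈ K, ρ g * b • e = b • e}
      one_mem' := ⟨Q.one_mem, fun b _ => by rw [map_one, one_mul]⟩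
      mul_mem' := fun {g g'} hg hg' => ⟨Q.mul_mem hg.1 hg'.1, fun b hb => by
        rw [map_mul, mul_assoc, hg'.2 b hb, hg.2 b hb]⟩
      inv_mem' := fun {g} hg => ⟨Q.inv_mem hg.1, fun b hb => map_inv_mul_of_eq ρ (hg.2 b hb)⟩ }
  have CQ : C ≤ Q := fun g hg => hg.1
  have hCp : IsPGroup q C := hQ.to_le CQ
  have := hCp.isNilpotent
  obtain ⟨n, hn⟩ := IsPGroup.iff_card.mp hCp
  have conj_scalar : ∀ (r : k) (a : X), (∀ b ∈ K, ∃ b' ∈ K, a⁻¹ • b • e = b' • e) →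
      ∀ g, (∀ b ∈ K, ρ g * b • e = r • b • e) → ∀ b ∈ K, ρ (a * g * a⁻¹) * b • e = r • b • e := by
    intro r a ha g hg b hb
    obtain ⟨b', hb', hbb⟩ := ha b hb
    rw [map_conj_mul, hbb, hg b' hb', conjAction_smul, ← hbb, smul_inv_smul]
  have permK : ∀ a ∈ K, ∀ b ∈ K, ∃ b' ∈ K, a⁻¹ • b • e = b' • e := fun a ha b hb =>
    ⟨a⁻¹ * b, K.mul_mem (K.inv_mem ha) hb, (mul_smul _ _ _).symm⟩
  have permh : ∀ b ∈ K, ∃ b' ∈ K, h₀⁻¹ • b • e = b' • e := fun b hb =>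
    ⟨h₀⁻¹ * b * h₀, by simpa using hHK h₀⁻¹ (H.inv_mem hh₀) b hb, by
      rw [mul_smul, h₀e, mul_smul]⟩
  have conjC : ∀ a : X, (∀ b ∈ K, ∃ b' ∈ K, a⁻¹ • b • e = b' • e) →
      (∀ y ∈ Q, a * y * a⁻¹ ∈ Q) → ∀ g ∈ C, a * g * a⁻¹ ∈ C := by
    intro a ha haQ g hg
    refine ⟨haQ g hg.1, fun b hb => ?_⟩
    rw [conj_scalar 1 a ha g (fun b hb => by rw [hg.2 b hb, one_smul]) b hb, one_smul]
  have quotC : ∀ s ∈ Q, ∀ s' ∈ Q, (∀ b ∈ K, ρ s * b • e = d • b • e) →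
      (∀ b ∈ K, ρ s' * b • e = d • b • e) → s⁻¹ * s' ∈ C := by
    intro s hs s' hs' h1 h2
    refine ⟨Q.mul_mem (Q.inv_mem hs) hs', fun b hb => ?_⟩
    rw [map_mul, mul_assoc, h2 b hb]
    exact map_inv_mul_of_eq ρ (h1 b hb)
  obtain ⟨c₀, hc₀, hcomm⟩ := exists_commute_of_coprime K C
    (by rw [hn]; exact Nat.Coprime.pow_right _ hKq) (fun a ha => conjC a (permK a ha) (KQ a ha)) t
    (fun a ha => quotC t htQ _ (KQ a ha t htQ) ht (conj_scalar d a (permK a ha) t ht))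
  set s := t * c₀ with hs_def
  have hsQ : s ∈ Q := Q.mul_mem htQ (CQ hc₀)
  have hs : ∀ b ∈ K, ρ s * b • e = d • b • e := by
    intro b hb
    rw [hs_def, map_mul, mul_assoc, hc₀.2 b hb, ht b hb]
  let D : Subgroup X := C ⊓ Subgroup.centralizer (K : Set X)
  have commh : ∀ g, (∀ a ∈ K, a * g = g * a) → ∀ a ∈ K, a * (h₀ * g * h₀⁻¹) = h₀ * g * h₀⁻¹ * a := by
    intro g hg a ha
    have h1 := hg (h₀⁻¹ * a * h₀) (by simpa using hHK h₀⁻¹ (H.inv_mem hh₀) a ha)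
    calc a * (h₀ * g * h₀⁻¹) = h₀ * ((h₀⁻¹ * a * h₀) * g) * h₀⁻¹ := by group
      _ = _ := by rw [h1]; group
  have memD : ∀ g, g ∈ D ↔ g ∈ C ∧ ∀ a ∈ K, a * g = g * a := fun g =>
    Subgroup.mem_inf.trans (and_congr_right fun _ => Subgroup.mem_centralizer_iff)
  have hbD : s⁻¹ * (h₀ * s * h₀⁻¹) ∈ D := by
    rw [memD]
    refine ⟨quotC s hsQ _ (HQ h₀ hh₀ s hsQ) hs (conj_scalar d h₀ permh s hs), fun a ha => ?_⟩
    have h1 : a * s⁻¹ = s⁻¹ * a := ((show Commute a s from hcomm a ha).inv_right)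
    rw [← mul_assoc, h1, mul_assoc, commh s hcomm a ha, ← mul_assoc]
  obtain ⟨δ, hδ, hδs⟩ := exists_eq_inv_mul_conj D (h := h₀)
    (fun g hg => by
      rw [memD] at hg ⊢
      exact ⟨conjC h₀ permh (HQ h₀ hh₀) g hg.1, commh g hg.2⟩)
    (fun g hg hgh => by
      rw [memD] at hg
      exact hQfix h₀ hh₀ hh₀1 g (CQ hg.1) hg.2 hgh) hbD
  rw [memD] at hδ
  -- The corrected element is centralized by `K` and by `h₀`, so it is trivial; then `s = δ ∈ C`
  -- acts trivially on `e`, against `d ≠ 1`.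
  have hone : s * δ⁻¹ = 1 := by
    refine hQfix h₀ hh₀ hh₀1 _ (Q.mul_mem hsQ (Q.inv_mem (CQ hδ.1))) (fun a ha => ?_) ?_
    · exact (show Commute a s from hcomm a ha).mul_right
        ((show Commute a δ from hδ.2 a ha).inv_right)
    · calc h₀ * (s * δ⁻¹) * h₀⁻¹ = s * (s⁻¹ * (h₀ * s * h₀⁻¹)) * (h₀ * δ * h₀⁻¹)⁻¹ := by group
        _ = s * δ⁻¹ := by rw [hδs]; group
  have hfin := hs 1 K.one_mem
  rw [mul_inv_eq_one.mp hone, hδ.1.2 1 K.one_mem, one_smul] at hfin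
  have : (d - 1) • e = 0 := by rw [sub_smul, one_smul, ← hfin, sub_self]
  exact he0 ((smul_eq_zero.mp this).resolve_left (sub_ne_zero.mpr hd))

end Ring

/-! ### Sums attached to linear characters -/

section Characters

variable {X k B : Type*} [Group X] [Field k] [Ring B] [Algebra k B]

/-- The element `∑ n, χ(n)⁻¹ n` attached to a linear character `χ` of a subgroup. -/
def charSum (ρ : X →* B) (N : Subgroup X) [Fintype N] (χ : N →* kˣ) : B :=
  ∑ n : N, ((χ n⁻¹ : kˣ) : k) • ρ n

variable (ρ : X →* B) (N : Subgroup X) [Fintype N]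

theorem map_mul_charSum (χ : N →* kˣ) (m : N) :
    ρ m * charSum ρ N χ = ((χ m : kˣ) : k) • charSum ρ N χ := by
  rw [charSum, Finset.mul_sum, Finset.smul_sum]
  refine Fintype.sum_equiv (Equiv.mulLeft m) _ _ fun n => ?_
  have h : χ m * χ (m * n)⁻¹ = χ n⁻¹ := by
    rw [map_inv, map_mul, mul_inv, mul_inv_cancel_left, map_inv]
  rw [mul_smul_comm, ← map_mul, Equiv.coe_mulLeft, smul_smul, ← Units.val_mul, h,
    Subgroup.coe_mul]

theorem charSum_mul_charSum_self (χ : N →* kˣ) :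
    charSum ρ N χ * charSum ρ N χ = (Nat.card N : k) • charSum ρ N χ := by
  nth_rw 1 [charSum]
  rw [Finset.sum_mul, Finset.sum_congr rfl (g := fun _ => charSum ρ N χ)]
  · rw [Finset.sum_const, Finset.card_univ, Nat.card_eq_fintype_card, Nat.cast_smul_eq_nsmul]
  · intro n _
    rw [smul_mul_assoc, map_mul_charSum, smul_smul, ← Units.val_mul, ← map_mul, inv_mul_cancel,
      map_one, Units.val_one, one_smul]

theorem charSum_mul_charSum_of_ne {χ ψ : N →* kˣ} (h : χ ≠ ψ) :
    charSum ρ N χ * charSum ρ N ψ = 0 := by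
  nth_rw 1 [charSum]
  rw [Finset.sum_mul]
  have h1 : ∀ n : N, ((χ n⁻¹ : kˣ) : k) • ρ n * charSum ρ N ψ =
      ((Units.coeHom k).comp (ψ / χ)) n • charSum ρ N ψ := by
    intro n
    rw [smul_mul_assoc, map_mul_charSum, smul_smul, ← Units.val_mul, MonoidHom.comp_apply,
      Units.coeHom_apply, MonoidHom.div_apply, map_inv, mul_comm, div_eq_mul_inv]
  rw [Finset.sum_congr rfl fun n _ => h1 n, ← Finset.sum_smul, sum_hom_units_eq_zero, zero_smul]
  intro h2
  refine h (MonoidHom.ext fun n => ?_)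
  have := DFunLike.congr_fun h2 n
  rw [MonoidHom.comp_apply, Units.coeHom_apply, MonoidHom.one_apply, Units.val_eq_one,
    MonoidHom.div_apply, div_eq_one] at this
  exact this.symm

theorem exists_conj_charSum (χ : N →* kˣ) {g : X} (hg : g ∈ Subgroup.normalizer (N : Set X)) :
    ∃ ψ : N →* kˣ, ρ g * charSum ρ N χ * ρ g⁻¹ = charSum ρ N ψ ∧
      ∀ n n' : N, (n' : X) = g * n * g⁻¹ → ψ n' = χ n := by
  let σ : MulAut N := N.normalizerMonoidHom ⟨g, hg⟩
  have hσ : ∀ n : N, (σ n : X) = g * n * g⁻¹ := fun n => rfl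
  refine ⟨χ.comp σ.symm.toMonoidHom, ?_, ?_⟩
  · rw [charSum, charSum, Finset.mul_sum, Finset.sum_mul]
    refine Fintype.sum_equiv σ.toEquiv _ _ fun n => ?_
    rw [mul_smul_comm, smul_mul_assoc, ← map_mul, ← map_mul]
    change _ = ((χ (σ.symm (σ n)⁻¹) : kˣ) : k) • ρ (σ n)
    rw [hσ, map_inv σ.symm, σ.symm_apply_apply]
  · intro n n' h
    have : n' = σ n := Subtype.ext (h.trans (hσ n).symm)
    rw [this]
    exact congrArg χ (σ.symm_apply_apply n)

/-- By orthogonality for the abelian group `N/N'`, the sum over `N'` is, up to the invertible factor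
`|N/N'|`, the sum of the elements `charSum` of the characters trivial on `N'`. -/
theorem sum_mul_eq_zero_of_charSum_mul_eq_zero [IsAlgClosed k] (N' : Subgroup X) [Fintype N'] (hle : N' ≤ N)
    (hnorm : N ≤ Subgroup.normalizer (N' : Set X)) (hcomm : ⁅N, N⁆ ≤ N')
    (hcard : (Nat.card N : k) ≠ 0) (b : B)
    (hb : ∀ χ : N →* kˣ, (∀ n : N, (n : X) ∈ N' → χ n = 1) → charSum ρ N χ * b = 0) :
    (∑ n : N', ρ n) * b = 0 := by
  classical
  let M : Subgroup N := N'.subgroupOf N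
  have : M.Normal := Subgroup.normal_subgroupOf_iff_le_normalizer hle |>.mpr hnorm
  let _ : CommGroup (N ⧸ M) :=
    { (inferInstance : Group (N ⧸ M)) with
      mul_comm := by
        intro a b
        obtain ⟨a, rfl⟩ := QuotientGroup.mk_surjective a
        obtain ⟨b, rfl⟩ := QuotientGroup.mk_surjective b
        change ((a * b : N) : N ⧸ M) = ((b * a : N) : N ⧸ M)
        rw [QuotientGroup.eq, Subgroup.mem_subgroupOf]
        refine hcomm ?_
        have := Subgroup.commutator_mem_commutator (N.inv_mem b.2) (N.inv_mem a.2)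
        convert this using 1
        simp only [commutatorElement_def, Subgroup.coe_mul, Subgroup.coe_inv, mul_inv_rev, inv_inv]
        group }
  have hA : (Nat.card (N ⧸ M) : k) ≠ 0 := by
    intro h
    apply hcard
    rw [M.card_eq_card_quotient_mul_card_subgroup, Nat.cast_mul, h, zero_mul]
  have : NeZero (Monoid.exponent (N ⧸ M) : k) := ⟨by
    intro h
    apply hA
    obtain ⟨c, hc⟩ := Group.exponent_dvd_nat_card (G := N ⧸ M)
    rw [hc, Nat.cast_mul, h, zero_mul]⟩
  have hdual := CommGroup.card_monoidHom_of_hasEnoughRootsOfUnity (N ⧸ M) k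
  have : Finite (N ⧸ M →* kˣ) := Nat.finite_of_card_ne_zero (by rw [hdual]; exact Nat.card_pos.ne')
  have := Fintype.ofFinite (N ⧸ M →* kˣ)
  have orth : ∀ a : N ⧸ M, ∑ χ : N ⧸ M →* kˣ, ((χ a : kˣ) : k) =
      if a = 1 then (Nat.card (N ⧸ M) : k) else 0 := by
    intro a
    split_ifs with ha
    · subst ha
      simp only [map_one, Units.val_one, Finset.sum_const, nsmul_eq_mul, mul_one]
      rw [Finset.card_univ, ← Nat.card_eq_fintype_card, hdual]
    · obtain ⟨φ, hφ⟩ := CommGroup.exists_apply_ne_one_of_hasEnoughRootsOfUnity (N ⧸ M) k ha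
      have h1 : ((φ a : kˣ) : k) * ∑ χ : N ⧸ M →* kˣ, ((χ a : kˣ) : k) =
          ∑ χ : N ⧸ M →* kˣ, ((χ a : kˣ) : k) := by
        rw [Finset.mul_sum]
        refine Fintype.sum_equiv (Equiv.mulLeft φ) _ _ fun χ => ?_
        rw [Equiv.coe_mulLeft, MonoidHom.mul_apply, Units.val_mul]
      have h2 : (((φ a : kˣ) : k) - 1) * ∑ χ : N ⧸ M →* kˣ, ((χ a : kˣ) : k) = 0 := by
        rw [sub_mul, h1, one_mul, sub_self]
      refine (mul_eq_zero.mp h2).resolve_left fun h => hφ ?_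
      exact Units.val_eq_one.mp (sub_eq_zero.mp h)
  have total : ∑ χ : N ⧸ M →* kˣ, charSum ρ N (χ.comp (QuotientGroup.mk' M)) =
      (Nat.card (N ⧸ M) : k) • ∑ n : N', ρ n := by
    simp only [charSum]
    rw [Finset.sum_comm]
    simp only [← Finset.sum_smul, MonoidHom.comp_apply, orth, ite_smul, zero_smul]
    rw [← Finset.sum_filter, ← Finset.smul_sum]
    congr 1
    refine Finset.sum_bij' (fun n hn => ⟨(n : X), ?_⟩) (fun n _ => ⟨(n : X), hle n.2⟩) ?_ ?_ ?_ ?_ ?_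
    · have := (Finset.mem_filter.mp hn).2
      rw [QuotientGroup.mk'_apply, QuotientGroup.eq_one_iff, inv_mem_iff,
        Subgroup.mem_subgroupOf] at this
      exact this
    · intro n _; exact Finset.mem_univ _
    · intro n _
      rw [Finset.mem_filter, QuotientGroup.mk'_apply, QuotientGroup.eq_one_iff, inv_mem_iff,
        Subgroup.mem_subgroupOf]
      exact ⟨Finset.mem_univ _, n.2⟩
    · intro n _; rfl
    · intro n _; rfl
    · intro n _; rfl
  have h1 : (Nat.card (N ⧸ M) : k) • ((∑ n : N', ρ n) * b) = 0 := by
    rw [← smul_mul_assoc, ← total, Finset.sum_mul]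
    refine Finset.sum_eq_zero fun χ _ => hb _ fun n hn => ?_
    rw [MonoidHom.comp_apply, QuotientGroup.mk'_apply,
      (QuotientGroup.eq_one_iff n).mpr (Subgroup.mem_subgroupOf.mpr hn), map_one]
  have h2 := congrArg (fun y => (Nat.card (N ⧸ M) : k)⁻¹ • y) h1
  simpa only [smul_smul, inv_mul_cancel₀ hA, one_smul, smul_zero] using h2

end Characters

/-! ### Descent along the lower central series -/

section Main

variable {X k B : Type*} [Group X] [Finite X] [Field k] [IsAlgClosed k] [Ring B] [Algebra k B]

theorem map_eq_one_of_sum_mul_eq_zero (ρ : X →* B) {q : ℕ} (hq : q.Prime) (hqk : (q : k) ≠ 0)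
    (K H Q : Subgroup X) [Fintype H]
    (hHK : ∀ h ∈ H, ∀ a ∈ K, h * a * h⁻¹ ∈ K)
    (hfix : ∀ h ∈ H, h ≠ 1 → ∀ a ∈ K, h * a * h⁻¹ = a → a = 1)
    (hKq : (Nat.card K).Coprime q) {x : X} (hxH : ∀ h ∈ H, h * x = x * h)
    (hQ : IsPGroup q Q) (hxQ : Q = Subgroup.closure {y | ∃ a ∈ K, y = a * x * a⁻¹})
    (hQfix : ∀ h ∈ H, h ≠ 1 → ∀ y ∈ Q, (∀ a ∈ K, a * y = y * a) → h * y * h⁻¹ = y → y = 1)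
    (hN : (∑ h : H, ρ h) * (ρ x - 1) = 0) : ρ x = 1 := by
  classical
  have : Fact q.Prime := ⟨hq⟩
  have := Fintype.ofFinite X
  have xmem : x ∈ Q := by
    rw [hxQ]; exact Subgroup.subset_closure ⟨1, K.one_mem, by group⟩
  have hnorm : K ⊔ H ≤ Subgroup.normalizer (Q : Set X) := by
    have := sup_le_normalizer_closure_conj K H hHK hxH
    rwa [← hxQ] at this
  have key : ∀ i : ℕ, (∑ n : Q.lowerCentralSeries i, ρ n) * (ρ x - 1) = 0 := by
    intro i
    induction i with
    | zero =>
      rw [mul_sub, mul_one, sub_eq_zero, Finset.sum_mul]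
      refine Fintype.sum_equiv (Equiv.mulRight (⟨x, xmem⟩ : Q)) _ _ fun n => ?_
      rw [← map_mul]; rfl
    | succ i ih =>
      set N := Q.lowerCentralSeries i with hNdef
      have hNQ : N ≤ Q := Subgroup.lowerCentralSeries_le_self Q i
      have hcomm : ⁅N, Q⁆ = Q.lowerCentralSeries (i + 1) := rfl
      have hcard : (Nat.card N : k) ≠ 0 := by
        obtain ⟨n, hn⟩ := IsPGroup.iff_card.mp (hQ.to_le hNQ)
        rw [hn, Nat.cast_pow]
        exact pow_ne_zero _ hqk
      have hNnorm : K ⊔ H ≤ Subgroup.normalizer (N : Set X) := by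
        intro g hg
        rw [Subgroup.mem_normalizer_iff_map_conj_eq]
        have h1 := Subgroup.mem_normalizer_iff_map_conj_eq.mp (hnorm hg)
        have h2 := Subgroup.map_lowerCentralSeries Q (MulAut.conj g).toMonoidHom i
        exact h2.trans (congrArg (fun S => S.lowerCentralSeries i) h1)
      have hQnorm : Q ≤ Subgroup.normalizer (N : Set X) :=
        Q.self_le_normalizer_lowerCentralSeries i
      refine sum_mul_eq_zero_of_charSum_mul_eq_zero (k := k) ρ N _
        (Q.lowerCentralSeries_antitone (Nat.le_succ i))
        (hNQ.trans (Q.self_le_normalizer_lowerCentralSeries (i + 1)))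
        (hcomm ▸ Subgroup.commutator_mono le_rfl hNQ) hcard _ fun χ hχ => ?_
      by_cases hχ1 : χ = 1
      · rw [hχ1]
        convert ih using 2
        exact Finset.sum_congr rfl fun n _ => by
          rw [MonoidHom.one_apply, Units.val_one, one_smul]
      obtain ⟨z, hz⟩ : ∃ z, χ z ≠ 1 := by
        by_contra! h
        exact hχ1 (MonoidHom.ext h)
      set E := charSum ρ N χ with hE
      have hEE := charSum_mul_charSum_self ρ N χ
      -- `χ` kills `[N, Q]`, so it is invariant under conjugation by `Q`.
      have heQ : ∀ y ∈ Q, ρ y * E = E * ρ y := by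
        intro y hy
        obtain ⟨ψ, hψ, hψχ⟩ := exists_conj_charSum ρ N χ (hQnorm hy)
        have : ψ = χ := by
          ext n'
          obtain ⟨n, hn⟩ : ∃ n : N, (n : X) = y⁻¹ * n' * y := ⟨⟨y⁻¹ * n' * y, by
            simpa using (Subgroup.mem_normalizer_iff.mp (hQnorm (Q.inv_mem hy)) n').mp n'.2⟩, rfl⟩
          have hn' : (n' : X) = y * n * y⁻¹ := by rw [hn]; group
          rw [hψχ n n' hn']
          have h1 : χ (n⁻¹ * n') = 1 := hχ _ (by
            rw [← hcomm]
            have := Subgroup.commutator_mem_commutator (N.inv_mem n.2) hy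
            convert this using 1
            rw [Subgroup.coe_mul, hn', Subgroup.coe_inv, commutatorElement_def, inv_inv]
            group)
          rw [map_mul, map_inv, inv_mul_eq_one] at h1
          rw [h1]
        rw [this] at hψ
        calc ρ y * E = ρ y * E * (ρ y⁻¹ * ρ y) := by rw [map_inv_mul_map, mul_one]
          _ = (ρ y * E * ρ y⁻¹) * ρ y := by simp only [mul_assoc]
          _ = E * ρ y := by rw [hψ]
      have hcore := map_mul_idempotent_eq (k := k) ρ hq K H Q hHK hfix hKq hxH hQ hxQ hQfix hN
        (e := (Nat.card N : k)⁻¹ • E) (z := z) (c := ((χ z : kˣ) : k)) (by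
          rw [smul_mul_smul_comm, hEE, smul_smul, mul_assoc, inv_mul_cancel₀ hcard, mul_one])
        (fun y hy => by rw [mul_smul_comm, smul_mul_assoc, heQ y hy])
        (fun g hg => by
          obtain ⟨ψ, hψ, -⟩ := exists_conj_charSum ρ N χ (hNnorm hg)
          rw [mul_smul_comm, smul_mul_assoc, hψ, smul_mul_smul_comm]
          by_cases h : ψ = χ
          · left; rw [h]
          · right; rw [charSum_mul_charSum_of_ne ρ N h, smul_zero])
        (hNQ z.2) (by rw [mul_smul_comm, map_mul_charSum, smul_comm])
        (fun h => hz (Units.val_eq_one.mp h))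
      rw [mul_smul_comm] at hcore
      have h3 := congrArg (fun y => (Nat.card N : k) • y) hcore
      simp only [smul_smul, mul_inv_cancel₀ hcard, one_smul] at h3
      rw [mul_sub, mul_one, ← heQ x xmem, h3, sub_self]
  have hnil : Group.IsNilpotent Q := hQ.isNilpotent
  obtain ⟨i, hi⟩ := Q.isNilpotent_iff_lowerCentralSeries.mp hnil
  have h := key i
  rw [Finset.sum_eq_single 1] at h
  · rw [Subgroup.coe_one, map_one, one_mul] at h
    exact sub_eq_zero.mp h
  · rintro ⟨n, hn⟩ _ hne
    rw [hi, Subgroup.mem_bot] at hn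
    exact absurd (Subtype.ext hn) hne
  · intro h; exact absurd (Finset.mem_univ _) h

end Main

/-! ### From modules to operators, and the main theorem -/

theorem mem_fixedSpace {k X V : Type*} [Field k] [Group X] [AddCommGroup V] [Module k V]
    (ρ : Representation k X V) (S : Subgroup X) (v : V) :
    v ∈ fixedSpace ρ S ↔ ∀ s ∈ S, ρ s v = v :=
  ⟨fun h s hs => h ⟨s, hs⟩, fun h s => h s s.2⟩

/-- If `x` commutes with `H` and acts trivially on the fixed space of `H`, then the sum over `H`
annihilates `ρ x - 1`. -/
theorem sum_mul_sub_one_eq_zero {k X V : Type*} [Field k] [Group X] [AddCommGroup V] [Module k V]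
    (ρ : Representation k X V) (S : Subgroup X) [Fintype S] {x : X} (hx : ∀ h ∈ S, h * x = x * h)
    (hfix : ∀ u ∈ fixedSpace ρ S, ρ x u = u) : (∑ h : S, ρ h) * (ρ x - 1) = 0 := by
  have hcomm : (∑ h : S, ρ h) * ρ x = ρ x * ∑ h : S, ρ h := by
    rw [Finset.sum_mul, Finset.mul_sum]
    exact Finset.sum_congr rfl fun h _ => by rw [← map_mul, ← map_mul, hx h h.2]
  rw [mul_sub, mul_one, hcomm, sub_eq_zero]
  refine LinearMap.ext fun v => hfix _ ((mem_fixedSpace ρ S _).mpr fun s hs => ?_)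
  rw [← Module.End.mul_apply, Finset.mul_sum]
  refine LinearMap.congr_fun ?_ v
  refine Fintype.sum_equiv (Equiv.mulLeft (⟨s, hs⟩ : S)) _ _ fun n => ?_
  rw [← map_mul]; rfl

end FrobeniusCarter

open FrobeniusCarter in
theorem proposition2p1 {G H : Type*} [Group G] [Group H] [Finite G] [Finite H] [Group.IsSolvable G]
    (φ : H →* MulAut G) (F : Subgroup G) (hF : IsCarter F)
    (hFinv : ∀ h : H, F.map (φ h).toMonoidHom = F)
    (hFrob : IsFrobeniusProduct (base φ F) (top φ))
    {p q : ℕ} (hp : p.Prime) (hq : q.Prime) (hpq : p ≠ q)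
    (Q : Subgroup G) (hQ : IsPGroup q Q) (hQnormal : (base φ Q).Normal)
    {k : Type*} [Field k] [CharP k p] {V : Type*} [AddCommGroup V] [Module k V]
    (ρ : Representation k (G ⋊[φ] H) V)
    (hQV : ∃ x ∈ base φ Q, ρ x ≠ 1)
    (hcase :
      (∀ h : H, h ≠ 1 →
        commutatorSpace ρ (fixedSpace ρ (base φ F)) (SemidirectProduct.inr h) =
          fixedSpace ρ (base φ F)) ∨
      p.Coprime (Nat.card H)) :
    kerOn ρ (centralizerIn φ Q) (fixedSpace ρ (top φ)) =
      kerOn ρ (centralizerIn φ Q) ⊤ := by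
  refine le_antisymm ?_ fun x hx => ⟨hx.1, fun u _ => hx.2 u trivial⟩
  rintro x ⟨⟨hxQ, hxH⟩, hxfix⟩
  refine ⟨⟨hxQ, hxH⟩, fun u _ => ?_⟩
  suffices ρ x = 1 by rw [this]; rfl
  have : Finite (G ⋊[φ] H) := Finite.of_equiv _ SemidirectProduct.equivProd.symm
  have := Fintype.ofFinite (top φ)
  have hxH : ∀ h ∈ top φ, h * x = x * h := Subgroup.mem_centralizer_iff.mp hxH
  have hQG : Q.Normal := ⟨fun n hn g => by
    obtain ⟨m, hm, hmg⟩ := hQnormal.conj_mem (SemidirectProduct.inl n) ⟨n, hn, rfl⟩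
      (SemidirectProduct.inl g)
    rw [← map_mul, ← map_inv, ← map_mul] at hmg
    rwa [← SemidirectProduct.inl_injective hmg]⟩
  have := hF.nilpotent
  obtain ⟨K, P, hKF, hPF, hKq, hP, hKP, hdec, hmemK, hmemP⟩ :=
    exists_coprime_decomposition F hq
  have centralF : ∀ y ∈ Q, (∀ a ∈ K, a * y = y * a) → y ∈ F := fun y hy hyK =>
    hF.mem_of_commute hq hKF hPF hP hKP hdec hmemP hQ hy hyK
  have hKinv : ∀ (h : H), ∀ a ∈ K, φ h a ∈ K := by
    intro h a ha
    have hF' : φ h a ∈ F := by rw [← hFinv h]; exact ⟨a, hKF ha, rfl⟩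
    rw [hmemK _ hF', MulEquiv.orderOf_eq]
    exact (hmemK a (hKF ha)).mp ha
  have hKbase : base φ K ≤ base φ F := Subgroup.map_mono hKF
  have hHK : ∀ h ∈ top φ, ∀ a ∈ base φ K, h * a * h⁻¹ ∈ base φ K := by
    rintro _ ⟨h, rfl⟩ _ ⟨a, ha, rfl⟩
    refine ⟨φ h a, hKinv h a ha, ?_⟩
    rw [SemidirectProduct.inl_aut, map_inv]
  let Q₀ : Subgroup (G ⋊[φ] H) := Subgroup.closure {y | ∃ a ∈ base φ K, y = a * x * a⁻¹}
  have hQ₀ : Q₀ ≤ base φ Q := by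
    rw [Subgroup.closure_le]
    rintro _ ⟨a, -, rfl⟩
    exact hQnormal.conj_mem x hxQ a
  -- Scalars are extended on the operator algebra rather than on `V`; injectivity of `ι` brings the
  -- equality `ρ x = 1` back.
  let ι : Module.End k V →ₐ[k] TensorProduct k (AlgebraicClosure k) (Module.End k V) :=
    Algebra.TensorProduct.includeRight
  have hι : Function.Injective ι :=
    Algebra.TensorProduct.includeRight_injective (algebraMap k (AlgebraicClosure k)).injective
  have hqk : (q : AlgebraicClosure k) ≠ 0 := by
    have := charP_of_injective_algebraMap (algebraMap k (AlgebraicClosure k)).injective p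
    rw [Ne, CharP.cast_eq_zero_iff (AlgebraicClosure k) p]
    exact fun h => hpq ((Nat.prime_dvd_prime_iff_eq hp hq).mp h)
  refine hι ?_
  rw [map_one]
  refine map_eq_one_of_sum_mul_eq_zero (k := AlgebraicClosure k)
    ((MonoidHomClass.toMonoidHom ι).comp ρ) hq hqk (base φ K) (top φ) Q₀ hHK
    (fun h hh hne a ha => hFrob.fixedPointFree h hh hne a (hKbase ha)) ?_ hxH
    ((hQ.map _).to_le hQ₀) rfl ?_ ?_
  · rwa [base, Subgroup.card_map_of_injective SemidirectProduct.inl_injective]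
  · intro h hh hne y hy hyK hhy
    refine hFrob.fixedPointFree h hh hne y ?_ hhy
    obtain ⟨m, hm, rfl⟩ := hQ₀ hy
    refine ⟨m, centralF m hm fun a ha => ?_, rfl⟩
    have := hyK _ ⟨a, ha, rfl⟩
    rw [← map_mul, ← map_mul] at this
    exact SemidirectProduct.inl_injective this
  · have := congrArg ι (sum_mul_sub_one_eq_zero ρ (top φ) hxH hxfix)
    rw [map_mul, map_sum, map_sub, map_one, map_zero] at this
    exact this
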